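/- Let $\mathbb S^3$ be the unit sphere of $\mathbb R^4$, with its standard volume (so $\operatorname{vol}\mathbb S^3=2\pi^2$). A geodesic simplex in $\mathbb S^3$ is the set of points of $\mathbb S^3$ in the convex cone spanned by four linearly independent unit vectors (its vertices); it is regular if all its edges have the same length. The Rational Simplex Problem asks whether every geodesic simplex in $\mathbb S^3$, all of whose interior dihedral angles are rational multiples of $\pi$, has a volume that is a rational multiple of $\operatorname{vol}\mathbb S^3$. For real $t$ with $|t|<1/10$ put $$f(t)=\frac1{\pi^2}\int_0^{\pi t}\arccos\Bigl(\frac{\sin s}{1+2\sin s}\Bigr)\,ds .$$ (1) For every real $t$ with $|t|<1/10$ there is a regular geodesic simplex in $\mathbb S^3$ all of whose interior dihedral angles equal $\pi/2+\pi t$, and every such simplex has volume $$\frac{\pi^2}{8}+3\pi^2t-3\pi^2f(t).$$ (2) If $t$ is rational, $|t|<1/10$, and $f(t)$ is irrational, then the Rational Simplex Problem has a negative answer. More precisely, there is a regular geodesic simplex in $\mathbb S^3$ with all interior dihedral angles equal to $\pi/2+\pi t$, hence in $\mathbb Q\pi$, whose volume is not in $\mathbb Q\pi^2$. -/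

import Mathlib

open Real MeasureTheory

/-- The unit 3-sphere `S³`, the set of unit vectors of the Euclidean space `ℝ⁴`. -/
abbrev UnitSphere3 : Type := Metric.sphere (0 : EuclideanSpace ℝ (Fin 4)) 1

/-- The three-dimensional volume on `S³`: the surface measure induced by Lebesgue measure on `ℝ⁴`
(a set `A` has measure `4` times the Lebesgue measure of the radial cone `(0,1) • A`). -/
noncomputable def sphereVolume : Measure UnitSphere3 :=
  (volume : Measure (EuclideanSpace ℝ (Fin 4))).toSphere

/-- A (nondegenerate) geodesic simplex in `S³`, given by its four linearly independent vertices. -/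
structure SphericalSimplex where
  vertex : Fin 4 → UnitSphere3
  linearIndependent :
    LinearIndependent ℝ (fun i => (vertex i : EuclideanSpace ℝ (Fin 4)))

namespace SphericalSimplex

/-- The points of the simplex: the points of `S³` in the convex cone spanned by the vertices,
i.e. the geodesic convex hull of the vertices. -/
def toSet (σ : SphericalSimplex) : Set UnitSphere3 :=
  {x | ∃ c : Fin 4 → ℝ, (∀ i, 0 ≤ c i) ∧
    (x : EuclideanSpace ℝ (Fin 4)) =
      ∑ i, c i • (σ.vertex i : EuclideanSpace ℝ (Fin 4))}

/-- The volume of the simplex. -/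
noncomputable def vol (σ : SphericalSimplex) : ℝ :=
  sphereVolume.real σ.toSet

/-- The spherical distance between the vertices `i` and `j`; for `i ≠ j`, the length of the edge
joining them. -/
noncomputable def edgeLength (σ : SphericalSimplex) (i j : Fin 4) : ℝ :=
  InnerProductGeometry.angle (σ.vertex i : EuclideanSpace ℝ (Fin 4))
    (σ.vertex j : EuclideanSpace ℝ (Fin 4))

/-- For `i ≠ j`, the linear plane in `ℝ⁴` carrying the edge that joins the two vertices other than
`i` and `j`. -/
def oppositeEdgePlane (σ : SphericalSimplex) (i j : Fin 4) :
    Submodule ℝ (EuclideanSpace ℝ (Fin 4)) :=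
  Submodule.span ℝ
    ((fun k => (σ.vertex k : EuclideanSpace ℝ (Fin 4))) '' {k | k ≠ i ∧ k ≠ j})

/-- For `i ≠ j`, the interior dihedral angle of the simplex at the edge joining the two vertices
other than `i` and `j`. The two faces that meet along this edge contain `i` and `j` respectively;
they cut the orthogonal complement of the plane of the edge in the rays spanned by the orthogonal
projections of the vertices `i` and `j`, and the dihedral angle is the angle of these rays. -/
noncomputable def dihedralAngle (σ : SphericalSimplex) (i j : Fin 4) : ℝ :=
  InnerProductGeometry.angle
    ((σ.oppositeEdgePlane i j)ᗮ.starProjection (σ.vertex i : EuclideanSpace ℝ (Fin 4)))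
    ((σ.oppositeEdgePlane i j)ᗮ.starProjection (σ.vertex j : EuclideanSpace ℝ (Fin 4)))

/-- A spherical simplex is regular if all its edges have the same length. -/
def IsRegular (σ : SphericalSimplex) : Prop :=
  ∃ x : ℝ, ∀ i j, i ≠ j → σ.edgeLength i j = x

/-- All interior dihedral angles are equal to `φ`. -/
def HasDihedralAngles (σ : SphericalSimplex) (φ : ℝ) : Prop :=
  ∀ i j, i ≠ j → σ.dihedralAngle i j = φ

/-- All interior dihedral angles are rational multiples of `π`. -/
def HasRationalDihedralAngles (σ : SphericalSimplex) : Prop :=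
  ∀ i j, i ≠ j → ∃ q : ℚ, σ.dihedralAngle i j = q * π

end SphericalSimplex

/-- The assertion that the Rational Simplex Problem has a positive answer: every geodesic simplex
in `S³` all of whose interior dihedral angles are rational multiples of `π` has a volume that is a
rational multiple of the volume of `S³`. -/
def RationalSimplexProblem : Prop :=
  ∀ σ : SphericalSimplex, σ.HasRationalDihedralAngles →
    ∃ q : ℚ, σ.vol = q * sphereVolume.real Set.univ

/-- The function `f(t) = (1/π²) ∫₀^{πt} arccos (sin s / (1 + 2 sin s)) ds`, used for
`|t| < 1/10`. -/
noncomputable def simplexF (t : ℝ) : ℝ :=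
  1 / π ^ 2 * ∫ s in (0 : ℝ)..(π * t), arccos (sin s / (1 + 2 * sin s))

/-!
The volume formula is Schläfli's differential formula for the family of regular simplices; it is
proved here directly, by writing the volume as a Gaussian integral over an orthant.

If the vertices of a regular simplex have pairwise inner products `a`, put `b = a / (1 - a)` and
`q_b(c) = ∑ cᵢ² + b (∑ cᵢ)²`. Polar coordinates (`integral_gaussian_cone`) and the linear change of
variables that maps the orthant to the cone over the simplex (`integral_gaussian_spannedCone`) show
that the volume is `2 √(1 + 4 b) M₄,₀(b)`, where `Mₙ,ₖ(b)` is the integral of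
`(∑ cᵢ)ᵏ exp (-q_b(c))` over the orthant in `ℝⁿ` (`orthantMoment`).

Since `∑ᵢ ∂ᵢ q_b = 2 (1 + n b) ∑ cᵢ`, integration by parts in each variable expresses `Mₙ₊₁,ₖ₊₁`
through the faces, that is through `Mₙ,ₖ`, and through `Mₙ₊₁,ₖ₋₁` (`orthantMoment_recursion`), and
`dMₙ,₀/db = -Mₙ,₂`. Hence the derivative of `√(1 + 4 b) M₄,₀` involves only `M₂,₀`, and that of
`√(1 + 2 b) M₂,₀` is elementary, which gives `2 √(1 + 2 b) M₂,₀(b) = arccos (b / (1 + b))`, the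
edge length of the simplex (`two_mul_sqrt_mul_orthantMoment_two`).

The dihedral angle `φ` of the simplex satisfies `cos φ = a / (1 + 2 a)`
(`SphericalSimplex.HasGram.dihedralAngle_eq`). With `φ = π / 2 + s` this reads
`b = -sin s / (1 + 3 sin s)`, and the volume has derivative
`3 (π - arccos (sin s / (1 + 2 sin s)))` in `s`. Integration from the simplex with right angles,
whose volume is `π² / 8`, gives the formula. For rational `t` it shows that the volume is a rational
multiple of `π²` exactly when `f(t)` is rational.
-/

/-! ### Gaussian moments of the orthant -/

/-- Lebesgue measure on the open orthant `(0, ∞)ⁿ`. -/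
noncomputable def orthantMeasure (n : ℕ) : Measure (Fin n → ℝ) :=
  Measure.pi fun _ => volume.restrict (Set.Ioi 0)

instance (n : ℕ) : SigmaFinite (orthantMeasure n) := by
  unfold orthantMeasure; infer_instance

/-- The function `(∑ cᵢ)ᵏ exp (-(∑ cᵢ² + b (∑ cᵢ)²))` of `c ∈ ℝⁿ`. -/
noncomputable def gaussianIntegrand (n k : ℕ) (b : ℝ) (c : Fin n → ℝ) : ℝ :=
  (∑ i, c i) ^ k * exp (-(∑ i, c i ^ 2 + b * (∑ i, c i) ^ 2))

/-- The integral of `(∑ cᵢ)ᵏ exp (-(∑ cᵢ² + b (∑ cᵢ)²))` over the orthant `(0, ∞)ⁿ`. -/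
noncomputable def orthantMoment (n k : ℕ) (b : ℝ) : ℝ :=
  ∫ c, gaussianIntegrand n k b c ∂orthantMeasure n

lemma continuous_gaussianIntegrand (n k : ℕ) (b : ℝ) : Continuous (gaussianIntegrand n k b) := by
  unfold gaussianIntegrand; fun_prop

lemma integrable_exp_neg_mul_sum_sq (n : ℕ) {δ : ℝ} (hδ : 0 < δ) :
    Integrable (fun c : Fin n → ℝ => exp (-δ * ∑ i, c i ^ 2)) (orthantMeasure n) := by
  have h : Integrable (fun c : Fin n → ℝ => ∏ i, exp (-δ * c i ^ 2)) (orthantMeasure n) :=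
    Integrable.fintype_prod (f := fun _ x => exp (-δ * x ^ 2))
      fun i => (integrable_exp_neg_mul_sq hδ).restrict
  simpa only [Finset.mul_sum, exp_sum] using h

lemma pow_sum_mul_exp_le (n k : ℕ) {δ : ℝ} (hδ : 0 < δ) (c : Fin n → ℝ) :
    |∑ i, c i| ^ k * exp (-δ * ∑ i, c i ^ 2) ≤
      k.factorial * exp (n / (2 * δ)) * exp (-(δ / 2) * ∑ i, c i ^ 2) := by
  have h1 : |∑ i, c i| ^ k ≤ k.factorial * exp |∑ i, c i| := by
    have := pow_div_factorial_le_exp _ (abs_nonneg (∑ i, c i)) k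
    rwa [div_le_iff₀' (by positivity)] at this
  have h2 : |∑ i, c i| ≤ δ / 2 * ∑ i, c i ^ 2 + n / (2 * δ) := by
    calc |∑ i, c i| ≤ ∑ i, |c i| := Finset.abs_sum_le_sum_abs _ _
      _ ≤ ∑ i, (δ / 2 * c i ^ 2 + 1 / (2 * δ)) := by
        refine Finset.sum_le_sum fun i _ => ?_
        have : δ / 2 * c i ^ 2 + 1 / (2 * δ) - |c i| = (δ * |c i| - 1) ^ 2 / (2 * δ) := by
          rw [← sq_abs (c i)]; field_simp; ring
        have h0 : 0 ≤ (δ * |c i| - 1) ^ 2 / (2 * δ) := by positivity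
        linarith
      _ = _ := by
        rw [Finset.sum_add_distrib, ← Finset.mul_sum]; simp; ring
  calc |∑ i, c i| ^ k * exp (-δ * ∑ i, c i ^ 2)
      ≤ (k.factorial * exp (δ / 2 * ∑ i, c i ^ 2 + n / (2 * δ))) * exp (-δ * ∑ i, c i ^ 2) := by
        gcongr; exact h1.trans (by gcongr)
    _ = _ := by
      rw [mul_assoc, mul_assoc, ← exp_add, ← exp_add]; congr 2; ring

lemma mul_sum_sq_le_quadratic {n : ℕ} {b b₁ : ℝ} (h : b₁ ≤ b) (h0 : b₁ ≤ 0) (c : Fin n → ℝ) :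
    (1 + n * b₁) * ∑ i, c i ^ 2 ≤ ∑ i, c i ^ 2 + b * (∑ i, c i) ^ 2 := by
  have h1 : (∑ i, c i) ^ 2 ≤ n * ∑ i, c i ^ 2 := by
    simpa using sq_sum_le_card_mul_sum_sq (s := Finset.univ) (f := c)
  nlinarith [mul_le_mul_of_nonneg_right h (sq_nonneg (∑ i, c i)),
    mul_le_mul_of_nonpos_left h1 h0]

/-- A bound that is uniform in `b ≥ b₁`, used to differentiate under the integral sign. -/
lemma abs_gaussianIntegrand_le (n k : ℕ) {b b₁ : ℝ} (h : b₁ ≤ b) (h0 : b₁ ≤ 0)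
    (h1 : 0 < 1 + n * b₁) (c : Fin n → ℝ) :
    |gaussianIntegrand n k b c| ≤ k.factorial * exp (n / (2 * (1 + n * b₁))) *
      exp (-((1 + n * b₁) / 2) * ∑ i, c i ^ 2) := by
  refine le_trans ?_ (pow_sum_mul_exp_le n k h1 c)
  rw [gaussianIntegrand, abs_mul, abs_pow, abs_exp]
  gcongr
  linarith [mul_sum_sq_le_quadratic h h0 c]

/-- Positivity of `1 + n b` means that the quadratic form `∑ cᵢ² + b (∑ cᵢ)²` is positive definite;
this persists for a slightly smaller parameter. -/
lemma exists_lower_parameter {n : ℕ} {b : ℝ} (hb : 0 < 1 + n * b) :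
    ∃ b₁ < b, b₁ ≤ 0 ∧ 0 < 1 + n * b₁ := by
  have h : ∀ᶠ x in nhdsWithin (min b 0) (Set.Iio (min b 0)), 0 < 1 + (n : ℝ) * x := by
    refine nhdsWithin_le_nhds ?_
    have hc : ContinuousAt (fun x : ℝ => 1 + (n : ℝ) * x) (min b 0) := by fun_prop
    refine hc.eventually_const_lt ?_
    rcases le_total b 0 with h | h
    · simpa [h] using hb
    · simp [h]
  obtain ⟨x, hx, hx'⟩ := (h.and self_mem_nhdsWithin).exists
  exact ⟨x, hx'.trans_le (min_le_left _ _), (hx'.trans_le (min_le_right _ _)).le, hx⟩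

lemma integrable_gaussianIntegrand {n : ℕ} (k : ℕ) {b : ℝ} (hb : 0 < 1 + n * b) :
    Integrable (gaussianIntegrand n k b) (orthantMeasure n) := by
  obtain ⟨b₁, h, h0, h1⟩ := exists_lower_parameter hb
  refine ((integrable_exp_neg_mul_sum_sq n (half_pos h1)).const_mul
    (k.factorial * exp (n / (2 * (1 + n * b₁))))).mono'
    (continuous_gaussianIntegrand n k b).aestronglyMeasurable ?_
  exact Filter.Eventually.of_forall fun c => abs_gaussianIntegrand_le n k h.le h0 h1 c

/-- Differentiation in `b` raises the degree by two. -/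
lemma hasDerivAt_orthantMoment {n : ℕ} (k : ℕ) {b : ℝ} (hb : 0 < 1 + n * b) :
    HasDerivAt (orthantMoment n k) (-orthantMoment n (k + 2) b) b := by
  obtain ⟨b₁, h, h0, h1⟩ := exists_lower_parameter hb
  have := hasDerivAt_integral_of_dominated_loc_of_deriv_le (μ := orthantMeasure n)
    (F := fun x c => gaussianIntegrand n k x c) (F' := fun x c => -gaussianIntegrand n (k + 2) x c)
    (x₀ := b) (s := Set.Ioi b₁) (Ioi_mem_nhds h)
    (Filter.Eventually.of_forall fun x =>
      (continuous_gaussianIntegrand n k x).aestronglyMeasurable)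
    (integrable_gaussianIntegrand k hb)
    (continuous_gaussianIntegrand n (k + 2) b).neg.aestronglyMeasurable
    (Filter.Eventually.of_forall fun c x hx => by
      rw [norm_neg]
      exact abs_gaussianIntegrand_le n (k + 2) (le_of_lt hx) h0 h1 c)
    ((integrable_exp_neg_mul_sum_sq n (half_pos h1)).const_mul _)
    (Filter.Eventually.of_forall fun c x _ => by
      unfold gaussianIntegrand
      have h2 : HasDerivAt (fun x : ℝ => -(∑ i, c i ^ 2 + x * (∑ i, c i) ^ 2))
          (-(∑ i, c i) ^ 2) x := by
        convert! (((hasDerivAt_id x).mul_const ((∑ i, c i) ^ 2)).const_add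
          (∑ i, c i ^ 2)).neg using 1
        simp
      convert! (h2.exp.const_mul ((∑ i, c i) ^ k)) using 1
      ring)
  rw [orthantMoment, ← integral_neg]
  exact this.2

/-- The partial derivative of `gaussianIntegrand n k b` in the direction of `cᵢ`. For `k = 0` the
truncated exponent `k - 1` is harmless, because the term has the factor `k`. -/
noncomputable def gaussianPartial (n k : ℕ) (b : ℝ) (i : Fin n) (c : Fin n → ℝ) : ℝ :=
  k * gaussianIntegrand n (k - 1) b c -
    2 * (c i * gaussianIntegrand n k b c) - 2 * b * gaussianIntegrand n (k + 1) b c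

lemma integrable_coord_mul_gaussianIntegrand {n : ℕ} (k : ℕ) {b : ℝ} (hb : 0 < 1 + n * b)
    (i : Fin n) :
    Integrable (fun c => c i * gaussianIntegrand n k b c) (orthantMeasure n) := by
  refine (integrable_gaussianIntegrand (k + 1) hb).mono'
    ((continuous_apply i).mul (continuous_gaussianIntegrand n k b)).aestronglyMeasurable ?_
  have hpos : ∀ᵐ c ∂orthantMeasure n, ∀ j, 0 < c j := by
    unfold orthantMeasure
    exact Filter.eventually_all.2 fun j =>
      Measure.tendsto_eval_ae_ae.eventually (ae_restrict_mem measurableSet_Ioi)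
  filter_upwards [hpos] with c hc
  have h1 : c i ≤ ∑ j, c j :=
    Finset.single_le_sum (fun j _ => (hc j).le) (Finset.mem_univ i)
  have h0 : 0 ≤ ∑ j, c j := (hc i).le.trans h1
  have h2 : 0 ≤ gaussianIntegrand n k b c := by unfold gaussianIntegrand; positivity
  rw [norm_mul, norm_of_nonneg (hc i).le, norm_of_nonneg h2]
  calc c i * gaussianIntegrand n k b c ≤ (∑ j, c j) * gaussianIntegrand n k b c := by gcongr
    _ = _ := by unfold gaussianIntegrand; ring

lemma integrable_gaussianPartial {n : ℕ} (k : ℕ) {b : ℝ} (hb : 0 < 1 + n * b) (i : Fin n) :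
    Integrable (gaussianPartial n k b i) (orthantMeasure n) := by
  unfold gaussianPartial
  exact (((integrable_gaussianIntegrand (k - 1) hb).const_mul _).sub
    ((integrable_coord_mul_gaussianIntegrand k hb i).const_mul _)).sub
    ((integrable_gaussianIntegrand (k + 1) hb).const_mul _)

/-- Integration by parts in one variable: only the face `cᵢ = 0` contributes. -/
lemma integral_gaussianPartial (n k : ℕ) {b : ℝ} (hb : 0 < 1 + ((n + 1 : ℕ) : ℝ) * b)
    (i : Fin (n + 1)) :
    ∫ c, gaussianPartial (n + 1) k b i c ∂orthantMeasure (n + 1) = -orthantMoment n k b := by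
  have hmp := measurePreserving_piFinSuccAbove
    (fun _ : Fin (n + 1) => volume.restrict (Set.Ioi (0 : ℝ))) i
  have hmp' := hmp.symm
  change MeasurePreserving _ ((volume.restrict (Set.Ioi (0 : ℝ))).prod (orthantMeasure n))
    (orthantMeasure (n + 1)) at hmp'
  set e := (MeasurableEquiv.piFinSuccAbove (fun _ : Fin (n + 1) => ℝ) i).symm with he
  have he' : ∀ x y, e (x, y) = i.insertNth x y := fun x y => rfl
  have hG : Integrable (gaussianIntegrand (n + 1) k b) (orthantMeasure (n + 1)) :=
    integrable_gaussianIntegrand k hb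
  have hP : Integrable (gaussianPartial (n + 1) k b i) (orthantMeasure (n + 1)) :=
    integrable_gaussianPartial k hb i
  have hG' := (hmp'.integrable_comp_emb e.measurableEmbedding).2 hG
  have hP' := (hmp'.integrable_comp_emb e.measurableEmbedding).2 hP
  rw [← hmp'.integral_comp e.measurableEmbedding, integral_prod_symm (fun z => gaussianPartial (n + 1) k b i (e z)) hP',
    orthantMoment,
    ← integral_neg]
  refine integral_congr_ae ?_
  filter_upwards [hG'.prod_left_ae, hP'.prod_left_ae] with y hy1 hy2
  simp only [Function.comp_apply] at hy1 hy2 ⊢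
  have hd : ∀ x : ℝ, HasDerivAt (fun x => gaussianIntegrand (n + 1) k b (e (x, y)))
      (gaussianPartial (n + 1) k b i (e (x, y))) x := by
    intro x
    simp only [gaussianIntegrand, gaussianPartial, he', Fin.sum_univ_succAbove _ i,
      Fin.insertNth_apply_same, Fin.insertNth_apply_succAbove]
    have h1 : HasDerivAt (fun x : ℝ => x + ∑ j, y j) 1 x := (hasDerivAt_id x).add_const _
    have h2 : HasDerivAt (fun x : ℝ => -(x ^ 2 + ∑ j, y j ^ 2 + b * (x + ∑ j, y j) ^ 2))
        (-(2 * x + b * (2 * (x + ∑ j, y j)))) x := by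
      have := ((((hasDerivAt_id x).pow 2).add_const (∑ j, y j ^ 2)).add
        ((h1.pow 2).const_mul b)).neg
      convert! this using 1
      simp
    convert! (h1.pow k).mul h2.exp using 1
    simp only [Pi.pow_apply]
    ring
  rw [integral_Ioi_of_hasDerivAt_of_tendsto' (fun x _ => hd x) hy2
    (tendsto_zero_of_hasDerivAt_of_integrableOn_Ioi (a := 0) (fun x _ => hd x) hy2 hy1), zero_sub]
  simp [gaussianIntegrand, he', Fin.sum_univ_succAbove _ i]

/-- The recursion on dimension and degree that replaces Schläfli's formula: the sum over `i` of the
integrations by parts in `cᵢ`. -/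
lemma orthantMoment_recursion (n k : ℕ) {b : ℝ} (hb : 0 < 1 + ((n + 1 : ℕ) : ℝ) * b) :
    2 * (1 + (n + 1) * b) * orthantMoment (n + 1) (k + 1) b =
      (n + 1) * (orthantMoment n k b + k * orthantMoment (n + 1) (k - 1) b) := by
  have h1 : ∫ c, ∑ i, gaussianPartial (n + 1) k b i c ∂orthantMeasure (n + 1) =
      -((n + 1) * orthantMoment n k b) := by
    rw [integral_finsetSum]
    · simp [integral_gaussianPartial n k hb]
    · exact fun i _ => integrable_gaussianPartial k hb i
  have h2 : ∀ c, ∑ i, gaussianPartial (n + 1) k b i c =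
      (n + 1) * k * gaussianIntegrand (n + 1) (k - 1) b c -
        2 * (1 + (n + 1) * b) * gaussianIntegrand (n + 1) (k + 1) b c := by
    intro c
    have h3 : gaussianIntegrand (n + 1) (k + 1) b c =
        (∑ i, c i) * gaussianIntegrand (n + 1) k b c := by
      unfold gaussianIntegrand; ring
    simp only [gaussianPartial, Finset.sum_sub_distrib, ← Finset.mul_sum, ← Finset.sum_mul]
    rw [← h3]
    simp
    ring
  simp only [h2] at h1
  rw [integral_sub ((integrable_gaussianIntegrand _ hb).const_mul _)
    ((integrable_gaussianIntegrand _ hb).const_mul _), integral_const_mul,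
    integral_const_mul] at h1
  simp only [orthantMoment] at h1 ⊢
  linarith

lemma orthantMoment_zero_zero (b : ℝ) : orthantMoment 0 0 b = 1 := by
  simp [orthantMoment, gaussianIntegrand, orthantMeasure, measureReal_def]

lemma orthantMoment_zero_right (n : ℕ) : orthantMoment n 0 0 = (√π / 2) ^ n := by
  have h := integral_fintype_prod_eq_prod (μ := fun _ : Fin n => volume.restrict (Set.Ioi (0 : ℝ)))
    (fun _ x => exp (-x ^ 2))
  have h2 : ∫ x in Set.Ioi (0 : ℝ), exp (-x ^ 2) = √π / 2 := by
    simpa using integral_gaussian_Ioi 1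
  simp only [h2, Finset.prod_const, Finset.card_univ, Fintype.card_fin] at h
  rw [← h, orthantMoment, orthantMeasure]
  simp [gaussianIntegrand, ← exp_sum]

/-! ### The derivative of the volume -/

lemma hasDerivAt_sqrt_one_add_mul (m : ℝ) {b : ℝ} (hb : 0 < 1 + m * b) :
    HasDerivAt (fun x => √(1 + m * x)) (m / (2 * √(1 + m * b))) b := by
  have h : HasDerivAt (fun x => 1 + m * x) m b := by
    simpa using ((hasDerivAt_id b).const_mul m).const_add 1
  exact h.sqrt hb.ne'

lemma hasDerivAt_sqrt_mul_orthantMoment_two {b : ℝ} (hb : -1 / 2 < b) :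
    HasDerivAt (fun x => 2 * (√(1 + 2 * x) * orthantMoment 2 0 x))
      (-1 / ((1 + b) * √(1 + 2 * b))) b := by
  have h2 : 0 < 1 + 2 * b := by linarith
  have h1 : 0 < 1 + b := by linarith
  have hM := hasDerivAt_orthantMoment (n := 2) 0 (b := b) (by push_cast; linarith)
  convert! ((hasDerivAt_sqrt_one_add_mul 2 h2).mul hM).const_mul 2 using 1
  have r1 := orthantMoment_recursion 1 1 (b := b) (by push_cast; linarith)
  have r2 := orthantMoment_recursion 0 0 (b := b) (by push_cast; linarith)
  norm_num [orthantMoment_zero_zero] at r1 r2 ⊢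
  have hs : 0 < √(1 + 2 * b) := sqrt_pos.2 h2
  have hss : √(1 + 2 * b) ^ 2 = 1 + 2 * b := sq_sqrt h2.le
  set r := √(1 + 2 * b)
  have e1 : orthantMoment 1 1 b = 1 / (2 * (1 + b)) := by field_simp; linarith
  have e2 : orthantMoment 2 2 b = (1 / (2 * (1 + b)) + orthantMoment 2 0 b) / (1 + 2 * b) := by
    rw [← e1]; field_simp; linarith
  rw [e2]
  clear_value r
  rw [← hss]
  field_simp
  ring

lemma hasDerivAt_arccos_div_one_add {b : ℝ} (hb : -1 / 2 < b) :
    HasDerivAt (fun x => arccos (x / (1 + x))) (-1 / ((1 + b) * √(1 + 2 * b))) b := by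
  have h2 : 0 < 1 + 2 * b := by linarith
  have h1 : 0 < 1 + b := by linarith
  have hd : HasDerivAt (fun x : ℝ => x / (1 + x)) (1 / (1 + b) ^ 2) b := by
    convert! (hasDerivAt_id b).div ((hasDerivAt_id b).const_add 1) h1.ne' using 1
    simp
  have hlt : b / (1 + b) < 1 := by rw [div_lt_one h1]; linarith
  have hgt : -1 < b / (1 + b) := by rw [lt_div_iff₀ h1]; linarith
  convert! (hasDerivAt_arccos hgt.ne' hlt.ne).comp b hd using 1
  have h : 1 - (b / (1 + b)) ^ 2 = (1 + 2 * b) / (1 + b) ^ 2 := by field_simp; ring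
  rw [h, sqrt_div h2.le, sqrt_sq h1.le]
  field_simp

/-- The planar case: the quadrant integral is the angle of a sector. Both sides have the same
derivative in `b` and agree at `b = 0`. -/
lemma two_mul_sqrt_mul_orthantMoment_two {b : ℝ} (hb : -1 / 2 < b) :
    2 * (√(1 + 2 * b) * orthantMoment 2 0 b) = arccos (b / (1 + b)) := by
  have hd : ∀ x ∈ Set.Ioi (-1 / 2 : ℝ), HasDerivAt
      (fun x => 2 * (√(1 + 2 * x) * orthantMoment 2 0 x) - arccos (x / (1 + x))) 0 x := by
    intro x hx
    simpa using! (hasDerivAt_sqrt_mul_orthantMoment_two hx).sub (hasDerivAt_arccos_div_one_add hx)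
  have := isOpen_Ioi.is_const_of_deriv_eq_zero isPreconnected_Ioi
    (fun x hx => (hd x hx).differentiableAt.differentiableWithinAt)
    (fun x hx => (hd x hx).deriv) (show b ∈ Set.Ioi (-1 / 2 : ℝ) from hb)
    (show (0 : ℝ) ∈ Set.Ioi (-1 / 2 : ℝ) by norm_num)
  have h0 : (2 : ℝ) * (√(1 + 2 * 0) * orthantMoment 2 0 0) - arccos (0 / (1 + 0)) = 0 := by
    rw [orthantMoment_zero_right, div_pow, sq_sqrt pi_pos.le]
    norm_num
    ring
  linarith

/-- Schläfli's differential formula for regular simplices, in the parameter `b`. -/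
lemma hasDerivAt_sqrt_mul_orthantMoment_four {b : ℝ} (hb : -1 / 4 < b) :
    HasDerivAt (fun x => 2 * (√(1 + 4 * x) * orthantMoment 4 0 x))
      (-(3 * arccos (b / (1 + b))) / ((1 + 3 * b) * (√(1 + 4 * b) * √(1 + 2 * b)))) b := by
  have h4 : 0 < 1 + 4 * b := by linarith
  have h3 : 0 < 1 + 3 * b := by linarith
  have h2 : 0 < 1 + 2 * b := by linarith
  have hM := hasDerivAt_orthantMoment (n := 4) 0 (b := b) (by push_cast; linarith)
  convert! ((hasDerivAt_sqrt_one_add_mul 4 h4).mul hM).const_mul 2 using 1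
  have r1 := orthantMoment_recursion 3 1 (b := b) (by push_cast; linarith)
  have r2 := orthantMoment_recursion 2 0 (b := b) (by push_cast; linarith)
  rw [← two_mul_sqrt_mul_orthantMoment_two (b := b) (by linarith)]
  norm_num at r1 r2 ⊢
  have hs : 0 < √(1 + 4 * b) := sqrt_pos.2 h4
  have hss : √(1 + 4 * b) ^ 2 = 1 + 4 * b := sq_sqrt h4.le
  set r := √(1 + 4 * b)
  have hs2 : 0 < √(1 + 2 * b) := sqrt_pos.2 h2
  have e1 : orthantMoment 3 1 b = 3 * orthantMoment 2 0 b / (2 * (1 + 3 * b)) := by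
    field_simp; linarith
  have e2 : orthantMoment 4 2 b =
      2 * (3 * orthantMoment 2 0 b / (2 * (1 + 3 * b)) + orthantMoment 4 0 b) / (1 + 4 * b) := by
    rw [← e1]; field_simp; linarith
  rw [e2]
  clear_value r
  rw [← hss]
  field_simp
  ring

/-- For the regular simplex with dihedral angle `π / 2 + s` the parameter is
`b = -sin s / (1 + 3 sin s)`. In terms of `s`, the derivative of the volume is three times the edge
length, which is half the sum of the lengths of the six edges. -/
lemma hasDerivAt_volume_dihedral {s : ℝ} (hs : |s| < π / 2) (hs3 : 0 < 1 + 3 * sin s) :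
    HasDerivAt (fun s => 2 * (√(1 + 4 * (-sin s / (1 + 3 * sin s))) *
        orthantMoment 4 0 (-sin s / (1 + 3 * sin s))))
      (3 * (π - arccos (sin s / (1 + 2 * sin s)))) s := by
  have hcos : 0 < cos s := cos_pos_of_mem_Ioo (abs_lt.1 hs)
  have hcs := sin_sq_add_cos_sq s
  have hlt : sin s < 1 := by nlinarith [sin_le_one s]
  have hd : HasDerivAt (fun s => -sin s / (1 + 3 * sin s)) (-cos s / (1 + 3 * sin s) ^ 2) s := by
    convert! (hasDerivAt_sin s).neg.div (((hasDerivAt_sin s).const_mul 3).const_add 1) hs3.ne'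
      using 1
    simp
    ring
  set u := sin s with hu
  have hne : 1 + u * 3 ≠ 0 := by linarith
  have h4 : 1 + 4 * (-u / (1 + 3 * u)) = (1 - u) / (1 + 3 * u) := by field_simp; ring
  have h3 : 1 + 3 * (-u / (1 + 3 * u)) = 1 / (1 + 3 * u) := by field_simp; ring
  have h2 : 1 + 2 * (-u / (1 + 3 * u)) = (1 + u) / (1 + 3 * u) := by field_simp; ring
  have h1 : 1 + -u / (1 + 3 * u) = (1 + 2 * u) / (1 + 3 * u) := by field_simp; ring
  have hb : -1 / 4 < -u / (1 + 3 * u) := by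
    have : 0 < (1 - u) / (1 + 3 * u) := div_pos (by linarith) hs3
    linarith
  have hsq : √((1 - u) / (1 + 3 * u)) * √((1 + u) / (1 + 3 * u)) = cos s / (1 + 3 * u) := by
    rw [← sqrt_mul (div_pos (by linarith) hs3).le]
    have : (1 - u) / (1 + 3 * u) * ((1 + u) / (1 + 3 * u)) = (cos s / (1 + 3 * u)) ^ 2 := by
      field_simp; linarith
    rw [this, sqrt_sq (div_pos hcos hs3).le]
  convert! (hasDerivAt_sqrt_mul_orthantMoment_four hb).comp s hd using 1
  have hq : -u / (1 + 3 * u) / ((1 + 2 * u) / (1 + 3 * u)) = -(u / (1 + 2 * u)) := by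
    have : 1 + u * 2 ≠ 0 := by linarith
    field_simp
  rw [h4, h3, h2, h1, hsq, hq, arccos_neg]
  field_simp

/-- The bound `π / 10 < 1 / 3` makes all denominators positive. -/
lemma abs_lt_and_sin_pos {s : ℝ} (hs : |s| < π / 10) :
    |s| < π / 2 ∧ 0 < 1 + 3 * sin s ∧ sin s < 1 := by
  have := pi_pos
  have h1 : |sin s| ≤ |s| := abs_sin_le_abs
  have h2 := abs_le.1 (h1.trans hs.le)
  refine ⟨by linarith, by linarith [pi_lt_d2], by linarith [pi_lt_d2]⟩

/-- Integration from the simplex with right dihedral angles, of volume `2π² / 16`. -/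
lemma volume_dihedral_eq {t : ℝ} (ht : |t| < 1 / 10) :
    2 * (√(1 + 4 * (-sin (π * t) / (1 + 3 * sin (π * t)))) *
        orthantMoment 4 0 (-sin (π * t) / (1 + 3 * sin (π * t)))) =
      π ^ 2 / 8 + 3 * π ^ 2 * t - 3 * π ^ 2 * simplexF t := by
  have hπ := pi_pos
  have habs : ∀ s ∈ Set.uIcc 0 (π * t), |s| < π / 10 := by
    intro s hs
    have h1 : |s| ≤ |π * t| := by simpa using Set.abs_sub_left_of_mem_uIcc hs
    rw [abs_mul, abs_of_pos hπ] at h1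
    nlinarith
  have hcont : ContinuousOn (fun s => arccos (sin s / (1 + 2 * sin s))) (Set.uIcc 0 (π * t)) := by
    refine continuous_arccos.comp_continuousOn (ContinuousOn.div (by fun_prop) (by fun_prop) ?_)
    intro s hs
    obtain ⟨-, h, h'⟩ := abs_lt_and_sin_pos (habs s hs)
    nlinarith
  have hint : IntervalIntegrable (fun s => arccos (sin s / (1 + 2 * sin s))) volume 0 (π * t) :=
    hcont.intervalIntegrable
  have key := intervalIntegral.integral_eq_sub_of_hasDerivAt
    (fun s hs => hasDerivAt_volume_dihedral (abs_lt_and_sin_pos (habs s hs)).1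
      (abs_lt_and_sin_pos (habs s hs)).2.1)
    ((intervalIntegrable_const.sub hint).const_mul 3)
  rw [intervalIntegral.integral_const_mul,
    intervalIntegral.integral_sub intervalIntegrable_const hint] at key
  have h0 : orthantMoment 4 0 0 = π ^ 2 / 16 := by
    rw [orthantMoment_zero_right, div_pow, show √π ^ 4 = (√π ^ 2) ^ 2 by ring, sq_sqrt hπ.le]
    norm_num
  simp [h0] at key
  have hf : 3 * π ^ 2 * simplexF t =
      3 * ∫ s in (0 : ℝ)..(π * t), arccos (sin s / (1 + 2 * sin s)) := by
    rw [simplexF, ← mul_assoc]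
    congr 1
    field_simp
  linarith

/-! ### Volumes of spherical simplices as Gaussian integrals -/

instance : IsFiniteMeasure sphereVolume := by
  unfold sphereVolume; infer_instance

lemma integral_volumeIoiPow_three :
    ∫ r : Set.Ioi (0 : ℝ), exp (-(r : ℝ) ^ 2) ∂Measure.volumeIoiPow 3 = 1 / 2 := by
  simp only [Measure.volumeIoiPow, ENNReal.ofReal]
  rw [integral_withDensity_eq_integral_smul
      (measurable_subtype_coe.pow_const _).real_toNNReal,
    integral_subtype_comap measurableSet_Ioi fun a : ℝ => Real.toNNReal (a ^ 3) • exp (-a ^ 2)]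
  have h := integral_rpow_mul_exp_neg_rpow (p := 2) (q := 3) (by norm_num) (by norm_num)
  rw [show ((3 : ℝ) + 1) / 2 = 1 + 1 by norm_num, Gamma_add_one one_ne_zero, Gamma_one] at h
  norm_num at h
  rw [← h]
  refine setIntegral_congr_fun measurableSet_Ioi fun x hx => ?_
  simp only [NNReal.smul_def, Real.coe_toNNReal _ (pow_nonneg (le_of_lt hx) 3), smul_eq_mul]

/-- Polar coordinates: the Gaussian integral over a cone is proportional to the volume of the
spherical region it cuts out. -/
lemma integral_gaussian_cone {K : Set (EuclideanSpace ℝ (Fin 4))} (hK : MeasurableSet K)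
    (hcone : ∀ x, ∀ r : ℝ, 0 < r → (r • x ∈ K ↔ x ∈ K)) :
    ∫ x in K, exp (-‖x‖ ^ 2) =
      sphereVolume.real {x : UnitSphere3 | (x : EuclideanSpace ℝ (Fin 4)) ∈ K} * (1 / 2) := by
  set A : Set UnitSphere3 := {x | (x : EuclideanSpace ℝ (Fin 4)) ∈ K} with hA
  have hAm : MeasurableSet A := measurable_subtype_coe hK
  have hmp := (volume : Measure (EuclideanSpace ℝ (Fin 4))).measurePreserving_homeomorphUnitSphereProd
  rw [finrank_euclideanSpace_fin] at hmp
  calc ∫ x in K, exp (-‖x‖ ^ 2)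
      = ∫ x, K.indicator (fun x => exp (-‖x‖ ^ 2)) x := (integral_indicator hK).symm
    _ = ∫ x : ({(0)}ᶜ : Set (EuclideanSpace ℝ (Fin 4))),
          K.indicator (fun x => exp (-‖x‖ ^ 2)) x.1 ∂(Measure.comap Subtype.val volume) := by
      rw [integral_subtype_comap (measurableSet_singleton _).compl
        (K.indicator fun x => exp (-‖x‖ ^ 2)), restrict_compl_singleton]
    _ = ∫ p, A.indicator (fun _ => (1 : ℝ)) p.1 * exp (-(p.2 : ℝ) ^ 2)
          ∂(sphereVolume.prod (Measure.volumeIoiPow 3)) := by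
      rw [sphereVolume, ← hmp.integral_comp (Homeomorph.measurableEmbedding _)]
      refine integral_congr_ae (Filter.Eventually.of_forall fun x => ?_)
      have hx : 0 < ‖(x : EuclideanSpace ℝ (Fin 4))‖ := norm_pos_iff.2 x.2
      have hmem : (homeomorphUnitSphereProd _ x).1 ∈ A ↔ x.1 ∈ K := by
        simp only [hA, Set.mem_ofPred_eq, homeomorphUnitSphereProd_apply_fst_coe]
        exact hcone _ _ (inv_pos.2 hx)
      by_cases h : x.1 ∈ K
      · simp [h, hmem.2 h]
      · simp [h, mt hmem.1 h]
    _ = _ := by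
      rw [integral_prod_mul (fun x => A.indicator (fun _ => (1 : ℝ)) x)
        (fun r : Set.Ioi (0 : ℝ) => exp (-(r : ℝ) ^ 2)), integral_volumeIoiPow_three,
        integral_indicator hAm]
      simp

lemma orthantMeasure_eq_restrict_Ici (n : ℕ) :
    orthantMeasure n = volume.restrict {c : Fin n → ℝ | ∀ i, 0 ≤ c i} := by
  have h : {c : Fin n → ℝ | ∀ i, 0 ≤ c i} = Set.univ.pi fun _ => Set.Ici 0 := by
    ext c; simp [Pi.le_def]
  rw [h, volume_pi, Measure.restrict_pi_pi, orthantMeasure]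
  simp only [Measure.restrict_congr_set Ioi_ae_eq_Ici]

/-- The closed convex cone spanned by four vectors of `ℝ⁴`. -/
def spannedCone (w : Fin 4 → EuclideanSpace ℝ (Fin 4)) : Set (EuclideanSpace ℝ (Fin 4)) :=
  {x | ∃ c : Fin 4 → ℝ, (∀ i, 0 ≤ c i) ∧ x = ∑ i, c i • w i}

lemma smul_mem_spannedCone {w : Fin 4 → EuclideanSpace ℝ (Fin 4)} {x : EuclideanSpace ℝ (Fin 4)}
    {r : ℝ} (hr : 0 ≤ r) (hx : x ∈ spannedCone w) : r • x ∈ spannedCone w := by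
  obtain ⟨c, hc, rfl⟩ := hx
  exact ⟨fun i => r * c i, fun i => mul_nonneg hr (hc i), by simp [Finset.smul_sum, mul_smul]⟩

lemma smul_mem_spannedCone_iff {w : Fin 4 → EuclideanSpace ℝ (Fin 4)}
    {x : EuclideanSpace ℝ (Fin 4)} {r : ℝ} (hr : 0 < r) :
    r • x ∈ spannedCone w ↔ x ∈ spannedCone w := by
  refine ⟨fun h => ?_, smul_mem_spannedCone hr.le⟩
  simpa [smul_smul, inv_mul_cancel₀ hr.ne'] using smul_mem_spannedCone (inv_pos.2 hr).le h

lemma spannedCone_smul (w : Fin 4 → EuclideanSpace ℝ (Fin 4)) {r : ℝ} (hr : 0 < r) :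
    spannedCone (fun i => r • w i) = spannedCone w := by
  ext x
  constructor
  · rintro ⟨c, hc, rfl⟩
    exact ⟨fun i => c i * r, fun i => mul_nonneg (hc i) hr.le, by simp [mul_smul]⟩
  · rintro ⟨c, hc, rfl⟩
    refine ⟨fun i => c i / r, fun i => div_nonneg (hc i) hr.le, ?_⟩
    simp [smul_smul, div_mul_cancel₀ _ hr.ne']

/-- The matrix whose columns are the vectors `w i`. -/
def columnMatrix (w : Fin 4 → EuclideanSpace ℝ (Fin 4)) : Matrix (Fin 4) (Fin 4) ℝ :=
  Matrix.of fun j i => w i j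

lemma toLp_columnMatrix_mulVec (w : Fin 4 → EuclideanSpace ℝ (Fin 4)) (c : Fin 4 → ℝ) :
    WithLp.toLp 2 (Matrix.toLin' (columnMatrix w) c) = ∑ i, c i • w i := by
  ext j
  simp [columnMatrix, Matrix.mulVec, dotProduct, mul_comm]

/-- The squared determinant is the Gram determinant `det (1 + b J)`, with `J` the all-ones matrix. -/
lemma det_columnMatrix_sq {w : Fin 4 → EuclideanSpace ℝ (Fin 4)} {b : ℝ}
    (hw : ∀ i j, inner ℝ (w i) (w j) = b + if i = j then 1 else 0) :
    (columnMatrix w).det ^ 2 = 1 + 4 * b := by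
  have h : (columnMatrix w).transpose * columnMatrix w =
      1 + Matrix.replicateCol Unit (fun _ : Fin 4 => b) *
        Matrix.replicateRow Unit (fun _ : Fin 4 => (1 : ℝ)) := by
    ext i j
    have : ((columnMatrix w).transpose * columnMatrix w) i j = inner ℝ (w i) (w j) := by
      rw [Matrix.mul_apply, PiLp.inner_apply]
      simp [columnMatrix, mul_comm]
    rw [this, hw]
    simp [Matrix.one_apply, Matrix.mul_apply, add_comm]
  rw [sq]
  nth_rewrite 1 [← Matrix.det_transpose]
  rw [← Matrix.det_mul, h, Matrix.det_one_add_replicateCol_mul_replicateRow]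
  simp [dotProduct]

lemma norm_sum_smul_sq {w : Fin 4 → EuclideanSpace ℝ (Fin 4)} {b : ℝ}
    (hw : ∀ i j, inner ℝ (w i) (w j) = b + if i = j then 1 else 0) (c : Fin 4 → ℝ) :
    ‖∑ i, c i • w i‖ ^ 2 = ∑ i, c i ^ 2 + b * (∑ i, c i) ^ 2 := by
  rw [← real_inner_self_eq_norm_sq]
  simp only [sum_inner, inner_sum, real_inner_smul_left, real_inner_smul_right, hw]
  simp only [Fin.sum_univ_four]
  simp
  ring

/-- The linear map sending the standard basis to `w` carries the orthant to the cone and has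
determinant `±√(1 + 4 b)`. -/
lemma integral_gaussian_spannedCone {w : Fin 4 → EuclideanSpace ℝ (Fin 4)} {b : ℝ}
    (hw : ∀ i j, inner ℝ (w i) (w j) = b + if i = j then 1 else 0) (hb : 0 < 1 + 4 * b) :
    MeasurableSet (spannedCone w) ∧
    ∫ x in spannedCone w, exp (-‖x‖ ^ 2) = √(1 + 4 * b) * orthantMoment 4 0 b := by
  have hdet := det_columnMatrix_sq hw
  have hd0 : (columnMatrix w).det ≠ 0 := by
    intro h; rw [h] at hdet; norm_num at hdet; linarith
  have hu : IsUnit (columnMatrix w).det := hd0.isUnit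
  set Q : Set (Fin 4 → ℝ) := {c | ∀ i, 0 ≤ c i} with hQ
  have hQm : MeasurableSet Q := by
    simp only [hQ, Set.ofPred_forall]
    exact MeasurableSet.iInter fun i => measurableSet_le measurable_const (measurable_pi_apply i)
  set T : (Fin 4 → ℝ) → EuclideanSpace ℝ (Fin 4) :=
    fun c => WithLp.toLp 2 (Matrix.toLin' (columnMatrix w) c) with hT
  have hinj : Function.Injective (Matrix.toLin' (columnMatrix w)) := by
    rw [Matrix.toLin'_apply']
    exact Matrix.mulVec_injective_of_isUnit ((Matrix.isUnit_iff_isUnit_det _).2 hu)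
  have hcont : Continuous (Matrix.toLin' (columnMatrix w)) :=
    LinearMap.continuous_of_finiteDimensional _
  have hemb : MeasurableEmbedding (Matrix.toLin' (columnMatrix w)) :=
    hcont.measurableEmbedding hinj
  have hlp : MeasurableEmbedding (WithLp.toLp 2 : (Fin 4 → ℝ) → EuclideanSpace ℝ (Fin 4)) :=
    (MeasurableEquiv.toLp 2 (Fin 4 → ℝ)).measurableEmbedding
  have hTemb : MeasurableEmbedding T := hlp.comp hemb
  have himage : spannedCone w = T '' Q := by
    ext x
    simp only [spannedCone, Set.mem_ofPred_eq, Set.mem_image, hT, hQ, toLp_columnMatrix_mulVec]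
    exact ⟨fun ⟨c, hc, h⟩ => ⟨c, hc, h.symm⟩, fun ⟨c, hc, h⟩ => ⟨c, hc, h.symm⟩⟩
  have hm : MeasurableSet (spannedCone w) := by
    rw [himage]; exact hTemb.measurableSet_image.2 hQm
  have hmap : Measure.map T volume =
      ENNReal.ofReal |((columnMatrix w).det)⁻¹| • (volume : Measure (EuclideanSpace ℝ (Fin 4))) := by
    rw [hT, ← Function.comp_def, ← Measure.map_map hlp.measurable hemb.measurable,
      Real.map_matrix_volume_pi_eq_smul_volume_pi hd0, Measure.map_smul,
      (PiLp.volume_preserving_toLp (Fin 4)).map_eq]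
  have hdabs : |(columnMatrix w).det| = √(1 + 4 * b) := by rw [← hdet, sqrt_sq_eq_abs]
  refine ⟨hm, ?_⟩
  have h1 : ∫ x in spannedCone w, exp (-‖x‖ ^ 2) ∂(Measure.map T volume) =
      orthantMoment 4 0 b := by
    rw [hTemb.setIntegral_map, himage, hTemb.injective.preimage_image, orthantMoment,
      orthantMeasure_eq_restrict_Ici]
    refine integral_congr_ae (Filter.Eventually.of_forall fun c => ?_)
    simp only [hT, gaussianIntegrand, toLp_columnMatrix_mulVec, norm_sum_smul_sq hw, pow_zero,
      one_mul]
  rw [hmap, Measure.restrict_smul, integral_smul_measure, ENNReal.toReal_ofReal (abs_nonneg _),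
    abs_inv, hdabs, smul_eq_mul] at h1
  rw [← h1, mul_inv_cancel_left₀ (sqrt_pos.2 hb).ne']

lemma sphereVolume_univ : sphereVolume.real Set.univ = 2 * π ^ 2 := by
  rw [sphereVolume, Measure.toSphere_real_apply_univ, measureReal_def, EuclideanSpace.volume_ball]
  have hG : Gamma (((4 : ℕ) : ℝ) / 2 + 1) = 2 := by
    rw [show (((4 : ℕ) : ℝ) / 2 + 1) = ((2 : ℕ) : ℝ) + 1 by norm_num, Gamma_nat_eq_factorial]
    norm_num
  rw [Fintype.card_fin, hG, show √π ^ 4 = (√π ^ 2) ^ 2 by ring, sq_sqrt pi_pos.le]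
  simp [ENNReal.toReal_ofReal (show 0 ≤ π ^ 2 / 2 by positivity)]
  ring

/-! ### Regular simplices and their dihedral angles -/

namespace SphericalSimplex

/-- The Gram matrix of the vertices has all off-diagonal entries equal to `a`. -/
def HasGram (σ : SphericalSimplex) (a : ℝ) : Prop :=
  ∀ i j, inner ℝ (σ.vertex i : EuclideanSpace ℝ (Fin 4)) (σ.vertex j) = if i = j then 1 else a

lemma norm_vertex (σ : SphericalSimplex) (i : Fin 4) :
    ‖(σ.vertex i : EuclideanSpace ℝ (Fin 4))‖ = 1 := by
  simp

lemma isRegular_iff_exists_hasGram (σ : SphericalSimplex) :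
    σ.IsRegular ↔ ∃ a, σ.HasGram a := by
  constructor
  · rintro ⟨x, hx⟩
    refine ⟨cos x, fun i j => ?_⟩
    split_ifs with h
    · rw [h, real_inner_self_eq_norm_sq, norm_vertex]; norm_num
    · have := InnerProductGeometry.cos_angle_mul_norm_mul_norm
        (σ.vertex i : EuclideanSpace ℝ (Fin 4)) (σ.vertex j)
      rw [← this, norm_vertex, norm_vertex, ← hx i j h, edgeLength]
      ring
  · rintro ⟨a, ha⟩
    refine ⟨arccos a, fun i j h => ?_⟩
    rw [edgeLength, InnerProductGeometry.angle, ha i j, if_neg h, norm_vertex, norm_vertex]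
    norm_num

namespace HasGram

variable {σ : SphericalSimplex} {a : ℝ}

/-- The Gram matrix is positive definite, so its eigenvalues `1 - a` and `1 + 3 a` are positive. -/
lemma bounds (h : σ.HasGram a) : 0 < 1 - a ∧ 0 < 1 + 3 * a := by
  constructor
  · have hne : (σ.vertex 0 : EuclideanSpace ℝ (Fin 4)) - σ.vertex 1 ≠ 0 := by
      intro h0
      have := σ.linearIndependent.injective (sub_eq_zero.1 h0)
      exact absurd this (by decide)
    have h1 := real_inner_self_pos.2 hne
    simp only [inner_sub_left, inner_sub_right, h _ _] at h1
    norm_num at h1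
    linarith
  · have hne : ∑ i, (σ.vertex i : EuclideanSpace ℝ (Fin 4)) ≠ 0 := by
      intro h0
      have := Fintype.linearIndependent_iff.1 σ.linearIndependent (fun _ => 1) (by simpa using h0) 0
      norm_num at this
    have h1 := real_inner_self_pos.2 hne
    simp only [sum_inner, inner_sum, h _ _] at h1
    have he : ∀ i j : Fin 4, (if i = j then 1 else a) = a + if i = j then 1 - a else 0 := by
      intro i j; split_ifs <;> ring
    simp [he, Finset.sum_add_distrib] at h1
    linarith

/-- The component of the vertex `i` orthogonal to the edge `kl`. -/
lemma starProjection_orthogonal_edge (h : σ.HasGram a) {i k l : Fin 4} (hik : i ≠ k)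
    (hil : i ≠ l) (hkl : k ≠ l) :
    (Submodule.span ℝ {(σ.vertex k : EuclideanSpace ℝ (Fin 4)),
        (σ.vertex l : EuclideanSpace ℝ (Fin 4))})ᗮ.starProjection (σ.vertex i) =
      (σ.vertex i : EuclideanSpace ℝ (Fin 4)) -
        (a / (1 + a)) • ((σ.vertex k : EuclideanSpace ℝ (Fin 4)) + σ.vertex l) := by
  obtain ⟨h1, h2⟩ := h.bounds
  have h3 : 1 + a ≠ 0 := by linarith
  refine Submodule.eq_starProjection_of_mem_of_inner_eq_zero ?_ ?_
  · rw [Submodule.mem_orthogonal']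
    intro y hy
    obtain ⟨p, q, rfl⟩ := Submodule.mem_span_pair.1 hy
    simp only [inner_sub_left, inner_add_left, inner_add_right, real_inner_smul_left,
      real_inner_smul_right, h _ _, hik, hil, hkl, hkl.symm, if_true, if_false]
    field_simp
    ring
  · intro y hy
    rw [sub_sub_cancel]
    refine (Submodule.mem_orthogonal _ _).1 hy _ (Submodule.smul_mem _ _ ?_)
    exact Submodule.add_mem _ (Submodule.subset_span (by simp)) (Submodule.subset_span (by simp))

/-- The projections of the vertices `i` and `j` have the same square norm
`(1 - a) (1 + 2 a) / (1 + a)`, and inner product `a (1 - a) / (1 + a)`. -/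
lemma dihedralAngle_eq (h : σ.HasGram a) {i j : Fin 4} (hij : i ≠ j) :
    σ.dihedralAngle i j = arccos (a / (1 + 2 * a)) := by
  obtain ⟨h1, h2⟩ := h.bounds
  have h3 : 0 < 1 + a := by linarith
  have h4 : 0 < 1 + 2 * a := by linarith
  obtain ⟨k, l, hik, hil, hjk, hjl, hkl, hset⟩ : ∃ k l : Fin 4, i ≠ k ∧ i ≠ l ∧ j ≠ k ∧ j ≠ l ∧
      k ≠ l ∧ ∀ m, (m ≠ i ∧ m ≠ j) ↔ (m = k ∨ m = l) := by
    revert i j; decide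
  have hplane : σ.oppositeEdgePlane i j = Submodule.span ℝ
      {(σ.vertex k : EuclideanSpace ℝ (Fin 4)), (σ.vertex l : EuclideanSpace ℝ (Fin 4))} := by
    have : {m | m ≠ i ∧ m ≠ j} = ({k, l} : Set (Fin 4)) := by ext m; simpa using hset m
    rw [oppositeEdgePlane, this, Set.image_pair]
  simp only [dihedralAngle, hplane]
  rw [h.starProjection_orthogonal_edge hik hil hkl,
    h.starProjection_orthogonal_edge hjk hjl hkl, InnerProductGeometry.angle]
  have hnorm : ∀ m : Fin 4, m ≠ k → m ≠ l →
      ‖(σ.vertex m : EuclideanSpace ℝ (Fin 4)) -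
        (a / (1 + a)) • ((σ.vertex k : EuclideanSpace ℝ (Fin 4)) + σ.vertex l)‖ =
      √((1 - a) * (1 + 2 * a) / (1 + a)) := by
    intro m hmk hml
    rw [← sqrt_sq (norm_nonneg _), ← real_inner_self_eq_norm_sq]
    congr 1
    simp only [inner_sub_left, inner_sub_right, inner_add_left, inner_add_right,
      real_inner_smul_left, real_inner_smul_right, h _ _, hmk, hmk.symm, hml, hml.symm, hkl,
      hkl.symm, if_true, if_false]
    field_simp
    ring
  rw [hnorm i hik hil, hnorm j hjk hjl, mul_self_sqrt (by positivity)]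
  congr 1
  simp only [inner_sub_left, inner_sub_right, inner_add_left, inner_add_right,
    real_inner_smul_left, real_inner_smul_right, h _ _, hij, hik, hil, hjk.symm,
    hjl.symm, hkl, hkl.symm, if_true, if_false]
  field_simp
  ring

/-- Rescaling the vertices by `(1 - a)^(-1/2)` does not change the cone and turns the Gram matrix
into `1 + b J`, where `b = a / (1 - a)` and `J` is the all-ones matrix. -/
lemma vol_eq (h : σ.HasGram a) :
    σ.vol = 2 * (√(1 + 4 * (a / (1 - a))) * orthantMoment 4 0 (a / (1 - a))) := by
  obtain ⟨h1, h2⟩ := h.bounds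
  set r := (√(1 - a))⁻¹ with hr
  have hr0 : 0 < r := inv_pos.2 (sqrt_pos.2 h1)
  have hrr : r * r = 1 / (1 - a) := by
    rw [hr, ← mul_inv, mul_self_sqrt h1.le, one_div]
  have hb : 0 < 1 + 4 * (a / (1 - a)) := by
    have : 1 + 4 * (a / (1 - a)) = (1 + 3 * a) / (1 - a) := by field_simp; ring
    rw [this]; positivity
  have hw : ∀ i j, inner ℝ (r • (σ.vertex i : EuclideanSpace ℝ (Fin 4)))
      (r • (σ.vertex j : EuclideanSpace ℝ (Fin 4))) = a / (1 - a) + if i = j then 1 else 0 := by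
    intro i j
    rw [real_inner_smul_left, real_inner_smul_right, h i j, ← mul_assoc, hrr]
    split_ifs
    · field_simp; ring
    · field_simp; ring
  obtain ⟨hm, hint⟩ := integral_gaussian_spannedCone hw hb
  rw [spannedCone_smul _ hr0] at hm hint
  rw [integral_gaussian_cone hm fun x r hr => smul_mem_spannedCone_iff hr] at hint
  rw [← hint, vol]
  change sphereVolume.real {x : UnitSphere3 | (x : EuclideanSpace ℝ (Fin 4)) ∈
    spannedCone fun i => (σ.vertex i : EuclideanSpace ℝ (Fin 4))} = _
  ring

end HasGram

lemma exists_hasGram {a : ℝ} (h1 : 0 < 1 - a) (h2 : 0 < 1 + 3 * a) :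
    ∃ σ : SphericalSimplex, σ.HasGram a := by
  set p := √(1 - a) with hp
  set m := √(1 + 3 * a) with hm
  -- The vertices are the columns of the square root `p • 1 + q • J` of the Gram matrix (`J` the
  -- all-ones matrix): its eigenvalues are `p` on vectors of coordinate sum zero, and `m = p + 4 q`
  -- on the all-ones vector.
  set q := (m - p) / 4 with hq
  have hpp : p ^ 2 = 1 - a := sq_sqrt h1.le
  have hmm : m ^ 2 = 1 + 3 * a := sq_sqrt h2.le
  have hp0 : 0 < p := sqrt_pos.2 h1
  have hm0 : 0 < m := sqrt_pos.2 h2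
  let v : Fin 4 → EuclideanSpace ℝ (Fin 4) :=
    fun i => WithLp.toLp 2 fun j => q + if i = j then p else 0
  have hv : ∀ i j, inner ℝ (v i) (v j) = if i = j then 1 else a := by
    intro i j
    have h : inner ℝ (v i) (v j) = 4 * q ^ 2 + 2 * p * q + if i = j then p ^ 2 else 0 := by
      rw [PiLp.inner_apply]
      simp only [v, RCLike.inner_apply, conj_trivial, add_mul, mul_add, Finset.sum_add_distrib]
      simp [eq_comm]
      split_ifs <;> ring
    rw [h, hq]
    split_ifs
    · linear_combination (3 / 4) * hpp + hmm / 4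
    · linear_combination -hpp / 4 + hmm / 4
  have hnorm : ∀ i, v i ∈ Metric.sphere (0 : EuclideanSpace ℝ (Fin 4)) 1 := by
    intro i
    have : ‖v i‖ ^ 2 = 1 := by rw [← real_inner_self_eq_norm_sq, hv, if_pos rfl]
    rw [mem_sphere_zero_iff_norm]
    exact (pow_eq_one_iff_of_nonneg (norm_nonneg _) two_ne_zero).1 this
  have hli : LinearIndependent ℝ v := by
    rw [Fintype.linearIndependent_iff]
    intro c hc
    have hj : ∀ j, q * ∑ i, c i + p * c j = 0 := by
      intro j
      have := congrArg (fun x : EuclideanSpace ℝ (Fin 4) => x j) hc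
      simp [v, mul_add, Finset.sum_add_distrib, ← Finset.sum_mul] at this
      linarith
    have hsum : m * ∑ i, c i = 0 := by
      have : ∑ j, (q * ∑ i, c i + p * c j) = 0 := Finset.sum_eq_zero fun j _ => hj j
      rw [Finset.sum_add_distrib, ← Finset.mul_sum (s := Finset.univ) (f := c)] at this
      simp at this
      rw [hq] at this
      linarith
    have hs : ∑ i, c i = 0 := (mul_eq_zero.1 hsum).resolve_left hm0.ne'
    intro j
    have := hj j
    rw [hs, mul_zero, zero_add] at this
    exact (mul_eq_zero.1 this).resolve_left hp0.ne'
  exact ⟨⟨fun i => ⟨v i, hnorm i⟩, hli⟩, hv⟩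

end SphericalSimplex

/-- The Gram entry is `a = -u / (1 + 2 u)` with `u = sin (π t)`, the solution of
`a / (1 + 2 a) = cos (π / 2 + π t)`. -/
theorem exists_regular_simplex {t : ℝ} (ht : |t| < 1 / 10) :
    ∃ σ : SphericalSimplex, σ.IsRegular ∧ σ.HasDihedralAngles (π / 2 + π * t) := by
  have hπ := pi_pos
  have hs : |π * t| < π / 10 := by rw [abs_mul, abs_of_pos hπ]; nlinarith
  obtain ⟨h2, h3, h1⟩ := abs_lt_and_sin_pos hs
  obtain ⟨h2, h2'⟩ := abs_lt.1 h2
  have hcos : cos (π / 2 + π * t) = -sin (π * t) := by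
    rw [add_comm, cos_add_pi_div_two]
  set u := sin (π * t)
  have h5 : 0 < 1 + 2 * u := by linarith
  have hne : 1 + u * 2 ≠ 0 := by linarith
  have e1 : 1 - -u / (1 + 2 * u) = (1 + 3 * u) / (1 + 2 * u) := by field_simp; ring
  have e2 : 1 + 3 * (-u / (1 + 2 * u)) = (1 - u) / (1 + 2 * u) := by field_simp; ring
  obtain ⟨σ, hσ⟩ := SphericalSimplex.exists_hasGram (a := -u / (1 + 2 * u))
    (by rw [e1]; positivity) (by rw [e2]; exact div_pos (by linarith) h5)
  refine ⟨σ, σ.isRegular_iff_exists_hasGram.2 ⟨_, hσ⟩, fun i j hij => ?_⟩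
  have e3 : -u / (1 + 2 * u) / (1 + 2 * (-u / (1 + 2 * u))) = -u := by
    have : 1 + 2 * (-u / (1 + 2 * u)) = 1 / (1 + 2 * u) := by field_simp; ring
    rw [this]; field_simp
  rw [hσ.dihedralAngle_eq hij, e3, ← hcos, arccos_cos (by linarith) (by linarith)]

/-- The dihedral angle determines the Gram matrix, hence the volume. -/
theorem vol_eq_of_regular {t : ℝ} (ht : |t| < 1 / 10) {σ : SphericalSimplex} (hreg : σ.IsRegular)
    (hσ : σ.HasDihedralAngles (π / 2 + π * t)) :
    σ.vol = π ^ 2 / 8 + 3 * π ^ 2 * t - 3 * π ^ 2 * simplexF t := by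
  obtain ⟨a, ha⟩ := σ.isRegular_iff_exists_hasGram.1 hreg
  obtain ⟨h1, h3⟩ := ha.bounds
  have hπ := pi_pos
  have hs : |π * t| < π / 10 := by rw [abs_mul, abs_of_pos hπ]; nlinarith
  obtain ⟨-, hu3, -⟩ := abs_lt_and_sin_pos hs
  have hang := hσ 0 1 (by decide)
  rw [ha.dihedralAngle_eq (by decide)] at hang
  have h2 : 0 < 1 + 2 * a := by linarith
  have hcos := congrArg cos hang
  rw [cos_arccos (by rw [le_div_iff₀ h2]; linarith) (by rw [div_le_one h2]; linarith),
    add_comm (π / 2), cos_add_pi_div_two, div_eq_iff h2.ne'] at hcos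
  have hb : a / (1 - a) = -sin (π * t) / (1 + 3 * sin (π * t)) := by
    rw [div_eq_div_iff h1.ne' hu3.ne']
    linear_combination hcos
  rw [ha.vol_eq, hb, volume_dihedral_eq ht]

/-! ### The volume formula and the Rational Simplex Problem -/

theorem mainTheorem1 :
    (∀ t : ℝ, |t| < 1 / 10 →
      (∃ σ : SphericalSimplex, σ.IsRegular ∧ σ.HasDihedralAngles (π / 2 + π * t)) ∧
      (∀ σ : SphericalSimplex, σ.IsRegular → σ.HasDihedralAngles (π / 2 + π * t) →
        σ.vol = π ^ 2 / 8 + 3 * π ^ 2 * t - 3 * π ^ 2 * simplexF t)) ∧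
    (∀ t : ℚ, |(t : ℝ)| < 1 / 10 → Irrational (simplexF t) →
      (∃ σ : SphericalSimplex, σ.IsRegular ∧ σ.HasDihedralAngles (π / 2 + π * t) ∧
        σ.HasRationalDihedralAngles ∧ ¬ ∃ q : ℚ, σ.vol = q * π ^ 2) ∧
      ¬ RationalSimplexProblem) := by
  refine ⟨fun t ht => ⟨exists_regular_simplex ht, fun σ => vol_eq_of_regular ht⟩,
    fun t ht hirr => ?_⟩
  obtain ⟨σ, hreg, hσ⟩ := exists_regular_simplex ht
  have hrat : σ.HasRationalDihedralAngles := fun i j hij =>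
    ⟨1 / 2 + t, by rw [hσ i j hij]; push_cast; ring⟩
  have hvol : ¬ ∃ q : ℚ, σ.vol = q * π ^ 2 := by
    rintro ⟨q, hq⟩
    rw [vol_eq_of_regular ht hreg hσ] at hq
    refine hirr ⟨1 / 24 + t - q / 3, ?_⟩
    push_cast
    have hπ : π ^ 2 ≠ 0 := pow_ne_zero 2 pi_ne_zero
    refine mul_left_cancel₀ hπ ?_
    linear_combination hq / 3
  refine ⟨⟨σ, hreg, hσ, hrat, hvol⟩, fun hRSP => hvol ?_⟩
  obtain ⟨q, hq⟩ := hRSP σ hrat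
  exact ⟨2 * q, by rw [hq, sphereVolume_univ]; push_cast; ring⟩
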